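/- Words are finite sequences of letters. The Zimin words over the variables $x_1,x_2,\dots$ are $Z_0=\lambda$ (the empty word), $Z_1=x_1$ and $Z_k=Z_{k-1}\,x_k\,Z_{k-1}$ for $k>1$. The Zimin type $\mathrm{Ztype}(w)$ of a finite word $w$ is the maximum $k\ge 0$ such that $w$ is the image of $Z_k$ under a non-erasing morphism; in particular, the empty word has Zimin type $0$. The Fibonacci words are defined by $F_{-1}=b$, $F_0=a$, $F_m=F_{m-1}F_{m-2}$ for $m\ge 1$; put $\Phi_m=|F_m|$, and let $F_\infty$ be the infinite Fibonacci word, that is, the unique infinite word having all $F_m$ ($m\ge 0$) as prefixes. Positions in $F_\infty$ are counted from $1$, and $F_\infty[1..m]$ denotes its prefix of length $m$. **Theorem.** Let $w$ be a factor of $F_\infty$ and let $n$ be the last position of the leftmost occurrence of $w$ in $F_\infty$ (with $n=0$ if $w$ is empty). If $k\ge 1$ is an integer such that $\Phi_{2(k-1)}\le n<\Phi_{2k}$, then $$\mathrm{Ztype}(w)\;\le\; k\;=\;\mathrm{Ztype}(F_{2(k-1)}).$$ Consequently, prefixes of $F_\infty$ dominate all its factors in Zimin type: there is $m\le n$ such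 that $\mathrm{Ztype}(w)\le\mathrm{Ztype}(F_\infty[1..m])$. -/

import Mathlib

namespace ZiminFib

/-! ### Zimin words and Zimin type -/

/-- The Zimin word of rank `k`, a word over the variables `x₁, x₂, …` (the variable `xᵢ` is
represented by the number `i`): `Z₁ = x₁` and `Zₖ = Zₖ₋₁ xₖ Zₖ₋₁` for `k > 1`; in rank `0` it is
the empty word. -/
def ziminWord : ℕ → List ℕ
  | 0 => []
  | k + 1 => ziminWord k ++ [k + 1] ++ ziminWord k

/-- `w` is an image of the pattern `p` under a non-erasing morphism; the morphism is given by
the images `h x` of the variables `x`, nonempty for every variable that occurs in `p`. -/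
def IsImage {α : Type*} (w : List α) (p : List ℕ) : Prop :=
  ∃ h : ℕ → List α, (∀ x ∈ p, h x ≠ []) ∧ w = p.flatMap h

/-- The Zimin type of a word `w`: the maximum `k` such that `w` is an image of the Zimin word of
rank `k` under a non-erasing morphism. The maximum exists, see `isGreatest_ztype`. -/
noncomputable def ztype {α : Type*} (w : List α) : ℕ :=
  sSup {k : ℕ | IsImage w (ziminWord k)}

theorem le_length_of_isImage {α : Type*} {w : List α} {k : ℕ} (hw : IsImage w (ziminWord k)) :
    k ≤ w.length := by
  obtain ⟨h, hne, rfl⟩ := hw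
  induction k with
  | zero => simp
  | succ k ih =>
    have h1 : 0 < (h (k + 1)).length :=
      List.length_pos_iff.mpr (hne _ (by simp [ziminWord]))
    have h2 := ih fun x hx => hne x (by simp [ziminWord, hx])
    simp only [ziminWord, List.flatMap_append, List.length_append, List.flatMap_cons,
      List.flatMap_nil, List.append_nil]
    omega

theorem isGreatest_ztype {α : Type*} (w : List α) :
    IsGreatest {k : ℕ | IsImage w (ziminWord k)} (ztype w) := by
  have hb : BddAbove {k : ℕ | IsImage w (ziminWord k)} :=
    ⟨w.length, fun _ hk => le_length_of_isImage hk⟩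
  refine ⟨Nat.sSup_mem ?_ hb, fun k hk => le_csSup hb hk⟩
  cases w with
  | nil => exact ⟨0, fun _ => [], by simp [ziminWord], by simp [ziminWord]⟩
  | cons c t => exact ⟨1, fun _ => c :: t, by simp, by simp [ziminWord]⟩

/-! ### Fibonacci words -/

/-- The binary alphabet of the Fibonacci words. -/
inductive Letter : Type
  | a : Letter
  | b : Letter

/-- The Fibonacci words `F₀ = a`, `F₁ = F₀ F₋₁ = ab` (where `F₋₁ = b`) and `Fₙ = Fₙ₋₁ Fₙ₋₂`. -/
def fibWord : ℕ → List Letter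
  | 0 => [Letter.a]
  | 1 => [Letter.a, Letter.b]
  | n + 2 => fibWord (n + 1) ++ fibWord n

/-- The Fibonacci numbers in the numbering `Φₙ = |Fₙ|`, that is `1, 2, 3, 5, 8, …`. -/
def fibLen (n : ℕ) : ℕ := (fibWord n).length

/-- The infinite Fibonacci word, as a sequence indexed from `0`: its letter number `i` is the
letter number `i` of `Fᵢ`, which is long enough (`lt_length_fibWord`), so that the default value
is never used. It is the unique infinite word having all `Fₙ` as prefixes, see
`eq_fibInf_iff`. -/
def fibInf (i : ℕ) : Letter := (fibWord i).getD i Letter.a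

/-- The block of length `l` of the infinite word `x` that starts after its first `i` letters, that
is the factor `x[i+1..i+l]` when positions are counted from `1`. -/
def block {α : Type*} (x : ℕ → α) (i l : ℕ) : List α :=
  (List.range l).map fun j => x (i + j)

/-- `w` occurs in the infinite word `x`, starting after the first `i` letters; counted from `1`,
its last position is `i + |w|`. -/
def OccursAt {α : Type*} (w : List α) (x : ℕ → α) (i : ℕ) : Prop :=
  block x i w.length = w

/-- `n` is the last position (counted from `1`) of the leftmost occurrence of `w` in `x`. In
particular, `w` is a factor of `x`. -/
def IsLastPosOfLeftmost {α : Type*} (w : List α) (x : ℕ → α) (n : ℕ) : Prop :=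
  ∃ i : ℕ, IsLeast {j : ℕ | OccursAt w x j} i ∧ n = i + w.length

theorem lt_length_fibWord (n : ℕ) : n < (fibWord n).length := by
  induction n using fibWord.induct with
  | case1 => simp [fibWord]
  | case2 => simp [fibWord]
  | case3 n ih1 ih2 =>
    simp only [fibWord, List.length_append]
    omega

theorem fibWord_prefix_of_le {m n : ℕ} (h : m ≤ n) : fibWord m <+: fibWord n := by
  induction n, h using Nat.le_induction with
  | base => exact List.prefix_rfl
  | succ n _ ih =>
    refine ih.trans ?_
    cases n with
    | zero => exact ⟨[Letter.b], rfl⟩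
    | succ n => exact List.prefix_append _ _

/-- The infinite Fibonacci word is the unique infinite word having all `Fₙ` as prefixes. -/
theorem eq_fibInf_iff (x : ℕ → Letter) :
    x = fibInf ↔ ∀ n, block x 0 (fibWord n).length = fibWord n := by
  constructor
  · rintro rfl n
    refine List.ext_getElem (by simp [block]) fun i _ h2 => ?_
    have h3 := lt_length_fibWord i
    simp only [block, fibInf, List.getElem_map, List.getElem_range, Nat.zero_add,
      List.getD_eq_getElem _ _ h3]
    rcases le_total i n with h | h
    · exact (fibWord_prefix_of_le h).getElem h3
    · exact ((fibWord_prefix_of_le h).getElem h2).symm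
  · intro h
    funext i
    have h3 := lt_length_fibWord i
    rw [fibInf, List.getD_eq_getElem _ _ h3, List.getElem_of_eq (h i).symm h3]
    simp [block]

end ZiminFib

namespace ZiminFib

/-! ### Fibonacci lengths -/

/-! A factor of Zimin type at least k + 1 has length at least Φ₂ₖ (`fibLen_le_length`); the bound
follows because |w| ≤ n. For the induction, write an image of the next Zimin word as u v u. The
prefix of u of length Φ₂ₖ repeats at distance g = |u v| > Φ₂ₖ. If this forces g ≥ Φ₂ₖ₊₁, then |u v
u| ≥ Φ₂ₖ₊₁ + Φ₂ₖ = Φ₂ₖ₊₂.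

The gap statement comes from coding the word by rotation by θ = `slope`. A repetition of a long
window forces gθ to be very close to an integer (`abs_mul_slope_sub_lt`), and no g strictly between
two consecutive Fibonacci lengths is that good (`fibLen_succ_le_of_abs_lt`).

Equality at F₂ₖ comes from F₂ₖ₊₂ = F₂ₖ F₂ₖ₋₁ F₂ₖ. -/

theorem fibLen_zero : fibLen 0 = 1 := rfl

theorem fibLen_one : fibLen 1 = 2 := rfl

theorem fibLen_add_two (m : ℕ) : fibLen (m + 2) = fibLen (m + 1) + fibLen m := by
  simp [fibLen, fibWord]

theorem lt_fibLen (m : ℕ) : m < fibLen m := lt_length_fibWord m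

theorem fibLen_mono : Monotone fibLen := fun _ _ h => (fibWord_prefix_of_le h).length_le

theorem fibLen_succ_le (m : ℕ) : fibLen (m + 1) ≤ 2 * fibLen m := by
  cases m with
  | zero => simp [fibLen_zero, fibLen_one]
  | succ m =>
    have := fibLen_mono (Nat.le_succ m)
    rw [fibLen_add_two]
    simp only [Nat.succ_eq_add_one] at this
    omega

/-! ### Counting letters in the infinite Fibonacci word -/

theorem fibInf_eq_getElem {m i : ℕ} (h : i < (fibWord m).length) : fibInf i = (fibWord m)[i] := by
  have h3 := lt_length_fibWord i
  rw [fibInf, List.getD_eq_getElem _ _ h3]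
  rcases le_total i m with hm | hm
  · exact (fibWord_prefix_of_le hm).getElem h3
  · exact ((fibWord_prefix_of_le hm).getElem h).symm

theorem fibInf_fibLen_add {m s : ℕ} (hs : s < fibLen m) :
    fibInf (fibLen (m + 1) + s) = fibInf s := by
  have h : fibLen (m + 1) + s < (fibWord (m + 2)).length := by
    have := fibLen_add_two m
    unfold fibLen at *
    omega
  rw [fibInf_eq_getElem h, fibInf_eq_getElem hs]
  simp [fibWord, fibLen]
  rfl

/-- The indicator of the letter `a`. -/
def Letter.isA : Letter → ℤ
  | .a => 1
  | .b => 0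

/-- The number of letters `a` in the prefix of length `t` of the infinite Fibonacci word. -/
def countA (t : ℕ) : ℤ := ∑ i ∈ Finset.range t, (fibInf i).isA

theorem countA_fibLen_add {m s : ℕ} (hs : s ≤ fibLen m) :
    countA (fibLen (m + 1) + s) = countA (fibLen (m + 1)) + countA s := by
  simp only [countA, Finset.sum_range_add]
  congr 1
  refine Finset.sum_congr rfl fun i hi => ?_
  rw [fibInf_fibLen_add (by have := Finset.mem_range.mp hi; omega)]

theorem countA_zero : countA 0 = 0 := rfl

theorem countA_one : countA 1 = 1 := rfl

theorem countA_two : countA 2 = 1 := rfl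

theorem countA_fibLen_add_two (m : ℕ) :
    countA (fibLen (m + 2)) = countA (fibLen (m + 1)) + countA (fibLen m) := by
  rw [fibLen_add_two, countA_fibLen_add le_rfl]

/-! ### The infinite Fibonacci word as a rotation word -/

/-- The inverse of the golden ratio, the frequency of the letter `a`. -/
noncomputable def slope : ℝ := (√5 - 1) / 2

theorem slope_sq : slope ^ 2 = 1 - slope := by
  have : √5 ^ 2 = (5 : ℝ) := Real.sq_sqrt (by norm_num)
  unfold slope
  linarith

theorem slope_pos : 0 < slope := by
  have : (1 : ℝ) < √5 := Real.lt_sqrt_of_sq_lt (by norm_num)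
  unfold slope
  linarith

theorem slope_lt_one : slope < 1 := by
  nlinarith [slope_sq, slope_pos]

/-- Both sides satisfy the Fibonacci recurrence, since -θ is a root of x² = x + 1. -/
theorem fibLen_mul_slope_sub (m : ℕ) :
    fibLen m * slope - countA (fibLen m) = -(-slope) ^ (m + 2) := by
  induction m using Nat.twoStepInduction with
  | zero => norm_num [fibLen_zero, countA_one, slope_sq]
  | one =>
    have := slope_sq
    norm_num [fibLen_one, countA_two]
    linear_combination (1 - slope) * this
  | more m ih1 ih2 =>
    rw [countA_fibLen_add_two, fibLen_add_two]
    push_cast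
    have h1 : (-slope) ^ (m + 2 + 2) = (-slope) ^ (m + 2) * (1 - slope) := by
      rw [pow_add _ (m + 2) 2, neg_sq, slope_sq]
    have h2 : (-slope) ^ (m + 1 + 2) = (-slope) ^ (m + 2) * -slope := by ring
    rw [h2] at ih2
    rw [h1]
    linear_combination ih1 + ih2

/-- The discrepancy `(t + 1) θ - |F_∞[1..t]|_a`, which is the fractional part of `(t + 1) θ`. -/
noncomputable def disc (t : ℕ) : ℝ := (t + 1) * slope - countA t

theorem disc_fibLen_add {m s : ℕ} (hs : s ≤ fibLen m) :
    disc (fibLen (m + 1) + s) = disc s - (-slope) ^ (m + 3) := by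
  have := fibLen_mul_slope_sub (m + 1)
  unfold disc
  rw [countA_fibLen_add hs]
  push_cast
  linear_combination this

/-- The margin makes the induction work: passing from s to Φₘ₊₁ + s moves `disc` by θ^(m+3), and
θ^(m+2) - θ^(m+3) = θ^(m+4). -/
theorem disc_bounds (m : ℕ) :
    ∀ s < fibLen m, slope ^ (m + 2) ≤ disc s ∧ disc s ≤ 1 - slope ^ (m + 2) := by
  have h0 : slope ^ 2 ≤ disc 0 ∧ disc 0 ≤ 1 - slope ^ 2 := by
    have := slope_sq
    have h5 : (2 : ℝ) ≤ √5 := Real.le_sqrt_of_sq_le (by norm_num)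
    simp only [disc, countA_zero, this]
    push_cast
    unfold slope
    constructor <;> linarith
  have hθ := slope_pos
  have h1 := slope_lt_one
  have hdec (n : ℕ) : slope ^ (n + 1) ≤ slope ^ n :=
    pow_le_pow_of_le_one hθ.le h1.le (Nat.le_succ n)
  induction m using Nat.twoStepInduction with
  | zero =>
    intro s hs
    obtain rfl : s = 0 := by simpa [fibLen_zero] using hs
    exact h0
  | one =>
    intro s hs
    rw [fibLen_one] at hs
    have := hdec 2
    interval_cases s
    · exact ⟨by linarith [h0.1], by linarith [h0.2]⟩
    · have hd : disc 1 = slope ^ 3 := by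
        simp only [disc, countA_one]
        push_cast
        linear_combination (1 - slope) * slope_sq
      have hc : slope ^ 3 = 2 * slope - 1 := by linear_combination (slope - 1) * slope_sq
      refine ⟨hd.ge, ?_⟩
      have : slope ≤ 3 / 4 := by nlinarith [slope_sq]
      norm_num [hd]
      linarith
  | more m ih1 ih2 =>
    intro s hs
    by_cases hsm : s < fibLen (m + 1)
    · have := hdec (m + 1 + 2)
      obtain ⟨h2, h3⟩ := ih2 s hsm
      constructor <;> ring_nf at * <;> linarith
    · obtain ⟨r, rfl⟩ := Nat.exists_eq_add_of_le (not_lt.mp hsm)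
      have hr : r < fibLen m := by
        rw [fibLen_add_two] at hs
        omega
      obtain ⟨h2, h3⟩ := ih1 r hr
      rw [disc_fibLen_add hr.le]
      have h4 : |(-slope) ^ (m + 3)| = slope ^ (m + 3) := by
        rw [abs_pow, abs_neg, abs_of_pos hθ]
      have h5 := abs_le.mp h4.le
      have h6 : slope ^ (m + 2 + 2) = slope ^ (m + 2) - slope ^ (m + 3) := by
        rw [pow_add _ (m + 2) 2, slope_sq]
        ring
      rw [h6]
      constructor <;> linarith [h5.1, h5.2]

theorem disc_nonneg (t : ℕ) : 0 ≤ disc t :=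
  (pow_pos slope_pos _).le.trans (disc_bounds t t (lt_fibLen t)).1

theorem disc_lt_one (t : ℕ) : disc t < 1 := by
  have := (disc_bounds t t (lt_fibLen t)).2
  have := pow_pos slope_pos (t + 2)
  linarith

/-! ### Distances between repetitions -/

theorem countA_sub_const {i g l : ℕ} (h : block fibInf i l = block fibInf (i + g) l) :
    ∀ t ≤ l, countA (i + t + g) - countA (i + t) = countA (i + g) - countA i := by
  intro t
  induction t with
  | zero => intro _; rfl
  | succ t ih =>
    intro ht
    have h1 : fibInf (i + t) = fibInf (i + t + g) := by
      have := List.getElem_of_eq h (i := t) (by simpa [block] using ht)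
      simpa [block, add_right_comm] using this
    have h2 := ih (by omega)
    have h3 : i + (t + 1) + g = i + t + g + 1 := by omega
    rw [h3, ← add_assoc]
    simp only [countA, Finset.sum_range_succ] at h2 ⊢
    rw [h1]
    linarith

/-- A window of length `Φₘ₊₂` repeats only at distances that are close to an integer multiple
of the inverse of the slope. -/
theorem abs_mul_slope_sub_lt {i g m : ℕ}
    (h : block fibInf i (fibLen (m + 2)) = block fibInf (i + g) (fibLen (m + 2))) :
    |g * slope - ((countA (i + g) - countA i : ℤ) : ℝ)| < slope ^ (m + 2) := by
  set D : ℝ := g * slope - ((countA (i + g) - countA i : ℤ) : ℝ) with hD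
  have hθ := slope_pos
  by_contra! hlt
  have hshift (t : ℕ) (ht : t ≤ fibLen (m + 2)) : disc (i + t + g) = disc (i + t) + D := by
    have := countA_sub_const h t ht
    rw [hD, ← this]
    unfold disc
    push_cast
    ring
  -- Both `disc` and its translate by D stay in [0, 1), so on the window `disc` varies by less than
  -- 1 - |D|.
  have hclose {s t : ℕ} (hs : s ≤ fibLen (m + 2)) (ht : t ≤ fibLen (m + 2)) :
      |disc (i + t) - disc (i + s)| < 1 - |D| := by
    have h1 := hshift s hs
    have h2 := hshift t ht
    have := disc_nonneg (i + s)
    have := disc_nonneg (i + t)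
    have := disc_nonneg (i + s + g)
    have := disc_nonneg (i + t + g)
    have := disc_lt_one (i + s)
    have := disc_lt_one (i + t)
    have := disc_lt_one (i + s + g)
    have := disc_lt_one (i + t + g)
    rw [abs_lt]
    rcases abs_cases D with ⟨h3, _⟩ | ⟨h3, _⟩ <;> rw [h3] <;> constructor <;> linarith
  -- A change known to be η modulo 1 is exactly η: since |η| ≤ |D|, there is no room to wrap around.
  have hmove {s t : ℕ} (hs : s ≤ fibLen (m + 2)) (ht : t ≤ fibLen (m + 2)) (η : ℝ) (c : ℤ)
      (hη : |η| ≤ slope ^ (m + 2)) (hst : ((t : ℝ) - s) * slope - c = η) :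
      disc (i + t) = disc (i + s) + η := by
    have h1 := hclose hs ht
    obtain ⟨z, hz⟩ : ∃ z : ℤ, disc (i + t) - disc (i + s) - η = z :=
      ⟨c - countA (i + t) + countA (i + s), by
        rw [← hst]
        unfold disc
        push_cast
        ring⟩
    have h2 : |(z : ℝ)| < 1 := by
      rw [← hz]
      have := abs_sub (disc (i + t) - disc (i + s)) η
      linarith
    have h3 : z = 0 := Int.abs_lt_one_iff.mp (by exact_mod_cast h2)
    rw [h3] at hz
    push_cast at hz
    linarith
  -- With this sign, moving forward by Φₘ₊₁ or back by Φₘ strictly raises ε * `disc`. One of the two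
  -- moves always stays in the window, of length Φₘ₊₁ + Φₘ, so no maximum can exist.
  set ε : ℝ := (-1) ^ (m + 2) with hε
  have hε2 : ε * ε = 1 := by rw [hε, ← mul_pow]; norm_num
  have hpow (n : ℕ) : |(-slope) ^ n| = slope ^ n := by
    rw [abs_pow, abs_neg, abs_of_pos hθ]
  have hεpow : (-slope) ^ (m + 2) = ε * slope ^ (m + 2) := neg_pow _ _
  obtain ⟨t, ht, hmax⟩ := Finset.exists_max_image (Finset.range (fibLen (m + 2)))
    (fun t => ε * disc (i + t)) ⟨0, Finset.mem_range.mpr (by have := lt_fibLen (m + 2); omega)⟩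
  rw [Finset.mem_range] at ht
  have hlen := fibLen_add_two m
  rcases lt_or_ge t (fibLen m) with hm | hm
  · have h1 := hmove ht.le (t := t + fibLen (m + 1)) (by omega) (-(-slope) ^ (m + 3))
      (countA (fibLen (m + 1)))
      (by rw [abs_neg, hpow]; exact pow_le_pow_of_le_one hθ.le slope_lt_one.le (by omega))
      (by
        have := fibLen_mul_slope_sub (m + 1)
        push_cast
        linear_combination this)
    have h2 := hmax (t + fibLen (m + 1)) (Finset.mem_range.mpr (by omega))
    have h3 : ε * -(-slope) ^ (m + 3) = slope ^ (m + 3) := by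
      rw [pow_succ (-slope) (m + 2), hεpow]
      linear_combination slope ^ (m + 3) * hε2
    simp only [h1, mul_add, h3] at h2
    linarith [pow_pos hθ (m + 3)]
  · have h1 := hmove ht.le (t := t - fibLen m) (by omega) ((-slope) ^ (m + 2))
      (-countA (fibLen m)) (hpow _).le
      (by
        have := fibLen_mul_slope_sub m
        rw [Nat.cast_sub hm]
        push_cast
        linear_combination -this)
    have h2 := hmax (t - fibLen m) (Finset.mem_range.mpr (by omega))
    have h3 : ε * (-slope) ^ (m + 2) = slope ^ (m + 2) := by
      rw [hεpow, ← mul_assoc, hε2, one_mul]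
    simp only [h1, mul_add, h3] at h2
    linarith [pow_pos hθ (m + 2)]

/-- Consecutive vectors (length, number of a's) form a basis of ℤ². -/
theorem exists_eq_combination (g c : ℤ) (j : ℕ) : ∃ A B : ℤ,
    g = A * fibLen j + B * fibLen (j + 1) ∧
      c = A * countA (fibLen j) + B * countA (fibLen (j + 1)) := by
  induction j with
  | zero =>
    refine ⟨2 * c - g, g - c, ?_, ?_⟩
    · simp only [zero_add, fibLen_zero, fibLen_one]
      push_cast
      ring
    · simp only [zero_add, fibLen_zero, fibLen_one, countA_one, countA_two]
      ring
  | succ j ih =>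
    obtain ⟨A, B, h1, h2⟩ := ih
    refine ⟨B - A, A, ?_, ?_⟩
    · rw [h1, fibLen_add_two]
      push_cast
      ring
    · rw [h2, countA_fibLen_add_two]
      ring

/-- In the Fibonacci basis the approximation error is ±θ^(j+2) (A - Bθ), so |A - Bθ| < θ⁻² = 2 + θ.
Together with Φⱼ < g < Φⱼ₊₁ ≤ 2Φⱼ this excludes every sign of B. -/
theorem fibLen_succ_le_of_abs_lt {g j : ℕ} {c : ℤ} (hg : fibLen j < g)
    (h : |g * slope - c| < slope ^ j) : fibLen (j + 1) ≤ g := by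
  by_contra! hlt
  obtain ⟨A, B, h1, h2⟩ := exists_eq_combination g c j
  have hθ := slope_pos
  have hΦ := fibLen_succ_le j
  have hpos : 0 < fibLen j := (Nat.zero_le j).trans_lt (lt_fibLen j)
  have hD : (g : ℝ) * slope - c = -(-slope) ^ j * (slope ^ 2 * (A - B * slope)) := by
    have e0 := fibLen_mul_slope_sub j
    have e1 := fibLen_mul_slope_sub (j + 1)
    have h1' : (g : ℝ) = A * fibLen j + B * fibLen (j + 1) := by exact_mod_cast h1
    have h2' : (c : ℝ) = A * countA (fibLen j) + B * countA (fibLen (j + 1)) := by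
      exact_mod_cast h2
    rw [h1', h2']
    linear_combination A * e0 + B * e1
  rw [hD, abs_mul, abs_neg, abs_pow, abs_neg, abs_of_pos hθ] at h
  have h3 : |slope ^ 2 * (A - B * slope)| < 1 := by
    have := pow_pos hθ j
    by_contra! hge
    nlinarith
  have hsmall : |(A : ℝ) - B * slope| < 2 + slope := by
    have h4 : slope ^ 2 * (2 + slope) = 1 := by
      linear_combination (slope + 1) * slope_sq
    rw [abs_mul, abs_of_pos (pow_pos hθ 2), ← h4] at h3
    exact lt_of_mul_lt_mul_left h3 (pow_pos hθ 2).le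
  obtain ⟨h5, h6⟩ := abs_lt.mp hsmall
  zify at hg hlt hΦ hpos
  rcases lt_trichotomy B 0 with hB | rfl | hB
  · have hA : 2 ≤ A := by
      by_contra! hA
      nlinarith
    have hA' : (2 : ℝ) ≤ A := by exact_mod_cast hA
    have hB' : (B : ℝ) ≤ -1 := by exact_mod_cast (by omega : B ≤ -1)
    nlinarith
  · have hA : 2 ≤ A := by
      by_contra! hA
      nlinarith
    nlinarith
  · have hA : A < 0 := by
      by_contra! hA
      nlinarith
    have hB' : (1 : ℝ) ≤ B := by exact_mod_cast hB
    have hA1 : -2 < A := by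
      by_contra! hA1
      have hA' : (A : ℝ) ≤ -2 := by exact_mod_cast hA1
      nlinarith
    obtain rfl : A = -1 := by omega
    have hB1 : 2 ≤ B := by
      by_contra! hB1
      nlinarith
    nlinarith

/-- A factor of length `Φ₂ₖ` does not repeat at a distance strictly between `Φ₂ₖ` and
`Φ₂ₖ₊₁`. -/
theorem fibLen_succ_le_of_block_eq {i g k : ℕ} (hg : fibLen (2 * k) < g)
    (h : block fibInf i (fibLen (2 * k)) = block fibInf (i + g) (fibLen (2 * k))) :
    fibLen (2 * k + 1) ≤ g := by
  -- A window of length Φ₀ = 1 is too short for the rotation argument, but there the claim is just 2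
  -- ≤ g.
  cases k with
  | zero => exact hg
  | succ k => exact fibLen_succ_le_of_abs_lt hg (abs_mul_slope_sub_lt h)

/-! ### Zimin types of factors -/

theorem block_append {α : Type*} (x : ℕ → α) (i l m : ℕ) :
    block x i (l + m) = block x i l ++ block x (i + l) m := by
  simp [block, List.range_add, Function.comp_def, add_assoc]

theorem length_block {α : Type*} (x : ℕ → α) (i l : ℕ) : (block x i l).length = l := by
  simp [block]

theorem occursAt_append {α : Type*} {u v : List α} {x : ℕ → α} {i : ℕ} :
    OccursAt (u ++ v) x i ↔ OccursAt u x i ∧ OccursAt v x (i + u.length) := by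
  simp only [OccursAt, List.length_append, block_append]
  constructor
  · intro h
    exact List.append_inj h (by simp [length_block])
  · rintro ⟨h1, h2⟩
    rw [h1, h2]

theorem block_eq_block_of_occursAt {α : Type*} {u : List α} {x : ℕ → α} {i i' l : ℕ}
    (hl : l ≤ u.length) (h : OccursAt u x i) (h' : OccursAt u x i') :
    block x i l = block x i' l := by
  have e : u.length = l + (u.length - l) := by omega
  have h2 : block x i u.length = block x i' u.length := h.trans h'.symm
  rw [e, block_append, block_append] at h2
  exact (List.append_inj h2 (by simp [length_block])).1

theorem fibLen_le_length {k i : ℕ} {w : List Letter} (hw : OccursAt w fibInf i)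
    (h : IsImage w (ziminWord (k + 1))) : fibLen (2 * k) ≤ w.length := by
  obtain ⟨f, hne, rfl⟩ := h
  induction k generalizing i with
  | zero => exact le_length_of_isImage ⟨f, hne, rfl⟩
  | succ k ih =>
    have e : (ziminWord (k + 1 + 1)).flatMap f =
        (ziminWord (k + 1)).flatMap f ++ f (k + 2) ++ (ziminWord (k + 1)).flatMap f := by
      rw [ziminWord]
      simp [List.flatMap_append]
    have hpos : 0 < (f (k + 2)).length :=
      List.length_pos_iff.mpr (hne _ (by simp [ziminWord]))
    rw [e] at hw ⊢
    obtain ⟨h12, h3⟩ := occursAt_append.mp hw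
    have h1 := (occursAt_append.mp h12).1
    have hlen := ih (fun x hx => hne x (by rw [ziminWord]; simp [hx])) h1
    -- The distance strictly exceeds Φ₂ₖ because the image of the middle variable is nonempty.
    have hgap := fibLen_succ_le_of_block_eq (k := k)
      (by simp only [List.length_append]; omega) (block_eq_block_of_occursAt hlen h1 h3)
    have := fibLen_add_two (2 * k)
    simp only [List.length_append] at hgap ⊢
    rw [show 2 * (k + 1) = 2 * k + 2 by ring]
    omega

theorem ztype_le_of_length_lt {k i : ℕ} {w : List Letter} (hw : OccursAt w fibInf i)
    (h : w.length < fibLen (2 * k)) : ztype w ≤ k := by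
  by_contra! hlt
  obtain ⟨r, hr⟩ := Nat.exists_eq_add_of_lt hlt
  have h1 := (isGreatest_ztype w).1
  rw [hr] at h1
  have h2 := fibLen_le_length hw h1
  have h3 := fibLen_mono (show 2 * k ≤ 2 * (k + r) by omega)
  omega

/-- The morphism that maps the Zimin word of rank `k + 1` to `F₂ₖ`. -/
def ziminToFib : ℕ → List Letter
  | 0 => []
  | 1 => [.a]
  | 2 => [.b]
  | n + 3 => fibWord (2 * n + 1)

theorem ziminToFib_ne_nil {n : ℕ} (hn : n ≠ 0) : ziminToFib n ≠ [] := by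
  match n with
  | 1 | 2 => simp [ziminToFib]
  | n + 3 =>
    have := lt_length_fibWord (2 * n + 1)
    exact List.ne_nil_of_length_pos (by simp only [ziminToFib]; omega)

theorem zero_notMem_ziminWord (k : ℕ) : 0 ∉ ziminWord k := by
  induction k with
  | zero => simp [ziminWord]
  | succ k ih => simp [ziminWord, ih]

/-- The middle variable of rank k + 2 goes to F₂ₖ₋₁, which is b when k = 0. -/
theorem flatMap_ziminToFib (k : ℕ) :
    (ziminWord (k + 1)).flatMap ziminToFib = fibWord (2 * k) := by
  induction k with
  | zero => simp [ziminWord, ziminToFib, fibWord]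
  | succ k ih =>
    rw [ziminWord, List.flatMap_append, List.flatMap_append, ih]
    cases k with
    | zero => simp [ziminToFib, fibWord]
    | succ k =>
      rw [show 2 * (k + 1 + 1) = 2 * k + 2 + 2 by ring, show 2 * (k + 1) = 2 * k + 2 by ring]
      simp [ziminToFib, fibWord]

theorem occursAt_fibWord (n : ℕ) : OccursAt (fibWord n) fibInf 0 :=
  (eq_fibInf_iff fibInf).mp rfl n

theorem ztype_fibWord (k : ℕ) : ztype (fibWord (2 * k)) = k + 1 := by
  apply le_antisymm
  · refine ztype_le_of_length_lt (occursAt_fibWord _) ?_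
    have := fibLen_add_two (2 * k)
    have := lt_fibLen (2 * k + 1)
    change fibLen (2 * k) < fibLen (2 * k + 2)
    omega
  · refine (isGreatest_ztype _).2 ⟨ziminToFib, fun x hx => ziminToFib_ne_nil ?_,
      (flatMap_ziminToFib k).symm⟩
    rintro rfl
    exact zero_notMem_ziminWord _ hx

theorem ztype_le_and_eq_ztype_fibWord {w : List Letter} {n k : ℕ}
    (hn : IsLastPosOfLeftmost w fibInf n) (hk : 1 ≤ k) (hlt : n < fibLen (2 * k)) :
    ztype w ≤ k ∧ k = ztype (fibWord (2 * (k - 1))) := by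
  obtain ⟨i, hi, rfl⟩ := hn
  refine ⟨ztype_le_of_length_lt hi.1 (by omega), ?_⟩
  rw [ztype_fibWord]
  omega

theorem exists_fibLen_le_lt {n : ℕ} (hn : 1 ≤ n) :
    ∃ k, fibLen (2 * k) ≤ n ∧ n < fibLen (2 * (k + 1)) := by
  have hex : ∃ k, n < fibLen (2 * (k + 1)) := ⟨n, by have := lt_fibLen (2 * (n + 1)); omega⟩
  classical
  refine ⟨Nat.find hex, ?_, Nat.find_spec hex⟩
  rcases h : Nat.find hex with _ | k
  · simpa [fibLen_zero] using hn
  · exact not_lt.mp (Nat.find_min hex (m := k) (by omega))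

end ZiminFib

theorem mainTheorem2 (w : List ZiminFib.Letter) (n : ℕ)
    (hn : ZiminFib.IsLastPosOfLeftmost w ZiminFib.fibInf n) :
    (∀ k : ℕ, 1 ≤ k → ZiminFib.fibLen (2 * (k - 1)) ≤ n → n < ZiminFib.fibLen (2 * k) →
      ZiminFib.ztype w ≤ k ∧ k = ZiminFib.ztype (ZiminFib.fibWord (2 * (k - 1)))) ∧
    ∃ m ≤ n, ZiminFib.ztype w ≤ ZiminFib.ztype (ZiminFib.block ZiminFib.fibInf 0 m) := by
  refine ⟨fun k hk _ hlt => ZiminFib.ztype_le_and_eq_ztype_fibWord hn hk hlt, ?_⟩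
  rcases Nat.eq_zero_or_pos n with rfl | hpos
  · obtain ⟨i, _, h⟩ := hn
    obtain rfl : w = [] := List.length_eq_zero_iff.mp (by omega)
    exact ⟨0, le_rfl, le_rfl⟩
  · obtain ⟨k, h1, h2⟩ := ZiminFib.exists_fibLen_le_lt hpos
    have h3 := ZiminFib.ztype_le_and_eq_ztype_fibWord hn (Nat.le_add_left 1 k) h2
    refine ⟨_, h1, ?_⟩
    rw [show ZiminFib.block ZiminFib.fibInf 0 (ZiminFib.fibLen (2 * k)) =
      ZiminFib.fibWord (2 * k) from ZiminFib.occursAt_fibWord _]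
    exact h3.1.trans h3.2.le
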